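/- Consider the deterministic Congested Clique model: $n$ nodes with identifiers $1,\dots,n$ communicate in synchronous rounds, in each of which every node may send a message of $O(\log n)$ bits to every other node; local computation is unrestricted. Let $G=(V,E)$ be a simple weighted directed graph on these $n$ nodes whose edge weights are positive integers bounded by a polynomial in $n$. Write $d_G(u,v)\in\mathbb{N}\cup\{\infty\}$ for the minimum length of a directed path from $u$ to $v$, and let $d$ be the weighted diameter of $G$, i.e. the maximum of $d_G(u,v)$ over all pairs $u,v$ such that $v$ is reachable from $u$ (all pairs, if $G$ is strongly connected). Let $a\ge 1$ and let $\delta$ be an $a$-approximation of APSP on $G$, that is, $d_G(u,v)\le\delta(u,v)\le a\cdot d_G(u,v)$ for all $u,v\in V$. Initially each node $u$ knows the edges of $G$ incident to it, with their weights, and the values $\delta(u,v)$ for all $v\in V$. For an integer $k\ge 0$ let $N_k(u)$ be the set of the $k$ nodes $v$ with the smallest values of $d_G(u,v)$, ties broken by identifiers. A weighted directed graph $H$ on $V$ is a $k$-nearest $\beta$-hopset for $G$ if $d_{G\cup H}(u,v)=d_G(u,v)$ for all $u,v\in V$, and for all $u\in V$ and all $v\in N_k(u)$ with $d_G(u,v)<\infty$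 there is a path in $G\cup H$ from $u$ to $v$ with at most $\beta$ edges and length exactly $d_G(u,v)$. Then there is a deterministic algorithm, which needs to know neither $a$ nor $d$, that computes in $O(1)$ rounds a $\lceil\sqrt n\rceil$-nearest $\beta$-hopset $H$ for $G$ with $\beta\in O(a\log d+1)$ (so $\beta\in O(a\log d)$ if $d\ge 2$); at the end every node knows the edges of $H$ incident to it, with their weights. The number of rounds and the constant in the bound on $\beta$ are absolute, and the constant in the message size depends only on the exponent of the polynomial that bounds the weights. -/

import Mathlib

open scoped ENNReal

/-- A simple directed graph on `V` with positive integer edge weights: `w u v` is the weight of the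
edge from `u` to `v`, and `w u v = ⊤` means that there is no such edge. -/
structure WDigraph (V : Type) where
  w : V → V → ℕ∞
  loopless : ∀ v, w v v = ⊤
  pos : ∀ u v, 0 < w u v

namespace WDigraph

variable {V : Type}

/-- The union of two weighted digraphs; of two parallel edges the lighter one is kept. -/
noncomputable def union (G H : WDigraph V) : WDigraph V where
  w u v := min (G.w u v) (H.w u v)
  loopless v := by simp [G.loopless, H.loopless]
  pos u v := lt_min (G.pos u v) (H.pos u v)

/-- `G.IsPath u v h L`: there is a directed path (repetitions allowed) from `u` to `v` in `G` with
exactly `h` hops and length (total weight) `L`. -/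
inductive IsPath (G : WDigraph V) : V → V → ℕ → ℕ → Prop
  | nil (u : V) : IsPath G u u 0 0
  | cons {u x v : V} {ℓ h L : ℕ} (hw : G.w u x = (ℓ : ℕ∞)) (hp : IsPath G x v h L) :
      IsPath G u v (h + 1) (ℓ + L)

/-- The distance from `u` to `v`: the minimum length of a path, `⊤` if there is none. -/
noncomputable def dist (G : WDigraph V) (u v : V) : ℕ∞ :=
  sInf {x : ℕ∞ | ∃ h L : ℕ, G.IsPath u v h L ∧ x = (L : ℕ∞)}

/-- The weighted diameter: the maximum distance `G.dist u v` over all pairs for which `v` is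
reachable from `u` (`ENat.toNat ⊤ = 0`, so other pairs do not contribute). For a strongly connected
graph this is the maximum over all pairs. -/
noncomputable def weightedDiam [Fintype V] (G : WDigraph V) : ℕ :=
  Finset.univ.sup fun p : V × V => (G.dist p.1 p.2).toNat

open Classical in
/-- `N_k(v)`: the `k` nodes `u` with the smallest distances from `v`, ties broken by identifiers
(that is, by the order on `V`). -/
noncomputable def nearest [Fintype V] [LinearOrder V] (G : WDigraph V) (k : ℕ) (v : V) : Finset V :=
  Finset.univ.filter fun u =>
    (Finset.univ.filter fun x =>
      G.dist v x < G.dist v u ∨ (G.dist v x = G.dist v u ∧ x < u)).card < k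

/-- `H` is a `k`-nearest `β`-hopset for `G`. In the second condition, nodes of `N_k(u)` at infinite
distance from `u` (which occur only if fewer than `k` nodes are reachable from `u`) are exempt. -/
def IsNearestHopset [Fintype V] [LinearOrder V] (G H : WDigraph V) (k β : ℕ) : Prop :=
  (∀ u v, (G.union H).dist u v = G.dist u v) ∧
  (∀ u, ∀ v ∈ G.nearest k u, ∀ L : ℕ, G.dist u v = (L : ℕ∞) →
    ∃ h ≤ β, (G.union H).IsPath u v h L)

/-- `δ` is an `a`-approximation of all-pairs shortest paths on `G`. -/
def IsApproxAPSP (G : WDigraph V) (a : ℝ) (δ : V → V → ℝ≥0∞) : Prop :=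
  ∀ u v, ((G.dist u v : ℕ∞) : ℝ≥0∞) ≤ δ u v ∧
    δ u v ≤ ENNReal.ofReal a * ((G.dist u v : ℕ∞) : ℝ≥0∞)

end WDigraph

/-- A deterministic algorithm in the congested clique with node set `Fin n` (the identifiers), in
which every message consists of `B` bits, every node has a local input in `I` and a local output
in `O`. Local memory and local computation are unrestricted, as usual in this model. -/
structure CliqueAlg (n B : ℕ) (I O : Type) where
  State : Type
  /-- initial state of a node, given its identifier and its local input -/
  init : Fin n → I → State
  /-- `send r u s v`: the message that `u`, being in state `s`, sends to `v` in round `r` -/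
  send : ℕ → Fin n → State → Fin n → (Fin B → Bool)
  /-- `step r v s m`: the new state of `v` after round `r`, where `m u` is the message from `u` -/
  step : ℕ → Fin n → State → (Fin n → Fin B → Bool) → State
  /-- local output of a node -/
  output : Fin n → State → O

namespace CliqueAlg

variable {n B : ℕ} {I O : Type}

/-- The state of each node after `r` synchronous rounds. -/
def stateAt (A : CliqueAlg n B I O) (inp : Fin n → I) : ℕ → Fin n → A.State
  | 0, v => A.init v (inp v)
  | r + 1, v => A.step r v (A.stateAt inp r v) fun u => A.send r u (A.stateAt inp r u) v

/-- The local outputs after `R` rounds. -/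
def run (A : CliqueAlg n B I O) (R : ℕ) (inp : Fin n → I) (v : Fin n) : O :=
  A.output v (A.stateAt inp R v)

end CliqueAlg

/-- The edges incident to one node: weights of outgoing and of incoming edges. -/
structure IncidentEdges (n : ℕ) where
  outW : Fin n → ℕ∞
  inW : Fin n → ℕ∞

/-- The part of a graph that the node `v` knows: its incident edges with their weights. -/
def WDigraph.incident {n : ℕ} (G : WDigraph (Fin n)) (v : Fin n) : IncidentEdges n where
  outW u := G.w v u
  inW u := G.w u v

/-! Let `k = ⌈√n⌉`. Each node `u` learns the `k` lightest outgoing edges of the `k` nodes that `δ u`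
ranks lowest. The hopset edge from `u` to `v` gets the distance in the graph `K u` of these edges.

Let `v ∈ N_k(u)` and follow a shortest path. Its nodes all have `v` among their `k` nearest, so each
next edge is among the `k` lightest at its node, and `K u` contains the path up to the first node
`y` outside the `δ`-ranked set (`exists_exit`). Hence the hopset edge from `u` to `y` is exact.
Counting gives a node `z` with `d(u,v) ≤ d(u,z) ≤ δ(u,z) ≤ δ(u,y) ≤ a d(u,y)`
(`dist_le_mul_of_notMem_lowest`). One hop thus shrinks the remaining distance by the factor `1 -
1/a`, and `⌊a log d⌋ + 1` hops bring it below 1, that is, to 0.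

Since `k² ≤ 4n`, the pairs (edge number, entry number) can be spread over four slots per node, so
four rounds of direct messages suffice. Neither `a` nor `d` enters the algorithm. -/

namespace WDigraph

variable {V : Type}

/-! ### Distances and shortest paths. -/

section Dist

variable {G H : WDigraph V} {u v x : V}

theorem IsPath.trans {h h' L L' : ℕ} (hp : G.IsPath u x h L) (hq : G.IsPath x v h' L') :
    G.IsPath u v (h + h') (L + L') := by
  induction hp with
  | nil => simpa using hq
  | cons hw _ ih =>
    convert IsPath.cons hw (ih hq) using 1 <;> omega

theorem IsPath.dist_le {h L : ℕ} (hp : G.IsPath u v h L) : G.dist u v ≤ L :=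
  sInf_le ⟨h, L, hp, rfl⟩

theorem exists_isPath_of_dist_eq {L : ℕ} (hd : G.dist u v = L) : ∃ h, G.IsPath u v h L := by
  have hne : {x : ℕ∞ | ∃ h L : ℕ, G.IsPath u v h L ∧ x = (L : ℕ∞)}.Nonempty := by
    rw [Set.nonempty_iff_ne_empty]
    intro he
    rw [dist, he, sInf_empty] at hd
    exact ENat.top_ne_natCast _ hd
  obtain ⟨h, L', hp, hL⟩ := csInf_mem hne
  rw [← dist, hd] at hL
  obtain rfl : L = L' := by exact_mod_cast hL
  exact ⟨h, hp⟩

theorem dist_self (G : WDigraph V) (u : V) : G.dist u u = 0 := by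
  simpa using (IsPath.nil (G := G) u).dist_le

theorem dist_triangle (G : WDigraph V) (u x v : V) : G.dist u v ≤ G.dist u x + G.dist x v := by
  rcases hA : G.dist u x with _ | A
  · exact le_of_le_of_eq le_top (top_add _).symm
  rcases hB : G.dist x v with _ | B
  · exact le_of_le_of_eq le_top (add_top _).symm
  obtain ⟨_, hp⟩ := exists_isPath_of_dist_eq hA
  obtain ⟨_, hq⟩ := exists_isPath_of_dist_eq hB
  exact (hp.trans hq).dist_le.trans_eq (Nat.cast_add A B)

theorem dist_le_w (G : WDigraph V) (u v : V) : G.dist u v ≤ G.w u v := by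
  rcases hw : G.w u v with _ | l
  · exact le_top
  · exact (IsPath.cons hw (IsPath.nil v)).dist_le

theorem eq_of_dist_eq_zero (hd : G.dist u v = 0) : u = v := by
  obtain ⟨h, hp⟩ := exists_isPath_of_dist_eq (L := 0) (by simpa using hd)
  generalize hL : (0 : ℕ) = L at hp
  cases hp with
  | nil => rfl
  | @cons _ x _ l _ _ hw _ =>
    obtain rfl : l = 0 := by omega
    simpa [hw] using G.pos u x

theorem IsPath.le_of_forall_dist_le_w (hw : ∀ y z, G.dist y z ≤ H.w y z) {h L : ℕ}
    (hp : H.IsPath u v h L) : G.dist u v ≤ L := by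
  induction hp with
  | nil u => simp [dist_self]
  | @cons u x v l h L hl _ ih =>
    calc G.dist u v ≤ G.dist u x + G.dist x v := G.dist_triangle u x v
      _ ≤ l + L := add_le_add (hl ▸ hw u x) ih
      _ = ((l + L : ℕ) : ℕ∞) := by push_cast; rfl

/-- Edges that never undercut `G`-distances create no shortcuts; this applies to the local graphs
and to the union with the hopset. -/
theorem dist_le_dist_of_forall_dist_le_w (hw : ∀ y z, G.dist y z ≤ H.w y z) (u v : V) :
    G.dist u v ≤ H.dist u v := by
  rcases hd : H.dist u v with _ | L
  · exact le_top
  · exact (exists_isPath_of_dist_eq hd).choose_spec.le_of_forall_dist_le_w hw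

theorem IsPath.length_le {h L M : ℕ} (hM : ∀ y z, G.w y z ≠ ⊤ → G.w y z ≤ M)
    (hp : G.IsPath u v h L) : L ≤ h * M := by
  induction hp with
  | nil => simp
  | @cons u x v l h L hl _ ih =>
    have : l ≤ M := by
      have := hM u x (by simp [hl])
      rw [hl] at this
      exact_mod_cast this
    rw [add_mul]
    omega

/-- Along a shortest path the distance to the target decreases strictly, so the nodes on it are
distinct. -/
theorem IsPath.hops_lt_card [Fintype V] {h L : ℕ} (hp : G.IsPath u v h L)
    (hd : G.dist u v = L) : h < Fintype.card V := by
  classical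
  -- Counting only the nodes within distance `L` of the target lets the induction run: each further
  -- edge adds at least its start node.
  suffices hs : h < (Finset.univ.filter fun y => G.dist y v ≤ (L : ℕ∞)).card from
    hs.trans_le (Finset.card_le_univ _)
  induction hp with
  | nil u => exact Finset.card_pos.2 ⟨u, by simp [dist_self]⟩
  | @cons u x v l h L hl hq ih =>
    have hx : G.dist x v = L := by
      refine le_antisymm hq.dist_le ?_
      have h1 := (G.dist_triangle u x v).trans (add_le_add_left (G.dist_le_w u x) _)
      rw [hd, hl] at h1
      push_cast at h1
      exact (ENat.add_le_add_iff_left (ENat.natCast_ne_top l)).1 h1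
    have hl0 : 0 < l := by simpa [hl] using G.pos u x
    refine (Nat.succ_le_of_lt (ih hx)).trans_lt (Finset.card_lt_card ?_)
    rw [Finset.ssubset_iff_of_subset]
    · refine ⟨u, by simp [hd], ?_⟩
      simp only [Finset.mem_filter, Finset.mem_univ, true_and, hd, not_le]
      exact_mod_cast (by omega : L < l + L)
    · intro y
      simp only [Finset.mem_filter, Finset.mem_univ, true_and]
      exact fun hy => hy.trans (by exact_mod_cast (by omega : L ≤ l + L))

/-- Bounds all finite distances, so that they fit into messages. -/
theorem dist_le_card_mul [Fintype V] {M : ℕ} (hM : ∀ y z, G.w y z ≠ ⊤ → G.w y z ≤ M)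
    {L : ℕ} (hd : G.dist u v = L) : L ≤ Fintype.card V * M := by
  obtain ⟨h, hp⟩ := exists_isPath_of_dist_eq hd
  exact (hp.length_le hM).trans (Nat.mul_le_mul_right _ (hp.hops_lt_card hd).le)

end Dist

end WDigraph

/-! ### Selecting the `k` smallest elements. -/

section Lowest

open Classical in
/-- The `k` elements with the smallest values of `f`, ties broken by the order on `V`. -/
noncomputable def lowest {V α : Type} [Fintype V] [LinearOrder V] [LinearOrder α]
    (f : V → α) (k : ℕ) : Finset V :=
  Finset.univ.filter fun u =>
    (Finset.univ.filter fun x => f x < f u ∨ (f x = f u ∧ x < u)).card < k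

variable {V α α' : Type} [Fintype V] [LinearOrder V] [LinearOrder α] [LinearOrder α']
  {f : V → α} {g : V → α'} {k : ℕ} {u v : V}

theorem mem_lowest_of_imp (hu : u ∈ lowest f k)
    (h : ∀ x, (g x < g v ∨ (g x = g v ∧ x < v)) → (f x < f u ∨ (f x = f u ∧ x < u))) :
    v ∈ lowest g k := by
  classical
  simp only [lowest, Finset.mem_filter, Finset.mem_univ, true_and] at hu ⊢
  refine lt_of_le_of_lt (Finset.card_le_card fun x => ?_) hu
  simpa using h x

theorem mem_lowest_of_lt (hu : u ∈ lowest f k) (h : f v < f u) : v ∈ lowest f k :=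
  mem_lowest_of_imp hu fun _ hx => Or.inl (hx.elim (·.trans h) fun hx => hx.1 ▸ h)

theorem card_lowest_le (f : V → α) (k : ℕ) : (lowest f k).card ≤ k := by
  classical
  rw [← Finset.card_range k]
  refine Finset.card_le_card_of_injOn
    (fun u => (Finset.univ.filter fun x => f x < f u ∨ (f x = f u ∧ x < u)).card) ?_ ?_
  · intro u hu
    simpa [lowest] using hu
  -- The rank increases strictly along the lexicographic order, which is total, so distinct elements
  -- have distinct ranks below `k`.
  · have key : ∀ u v, (f u < f v ∨ (f u = f v ∧ u < v)) →
        (Finset.univ.filter fun x => f x < f u ∨ (f x = f u ∧ x < u)).card <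
          (Finset.univ.filter fun x => f x < f v ∨ (f x = f v ∧ x < v)).card := by
      intro u v huv
      refine Finset.card_lt_card ((Finset.ssubset_iff_of_subset fun x => ?_).2 ⟨u, ?_, ?_⟩)
      · simp only [Finset.mem_filter, Finset.mem_univ, true_and]
        grind
      · simpa using huv
      · simp
    intro u _ v _ huv
    by_contra hne
    have : (f u < f v ∨ (f u = f v ∧ u < v)) ∨ (f v < f u ∨ (f v = f u ∧ v < u)) := by grind
    rcases this with h | h
    · exact (key u v h).ne huv
    · exact (key v u h).ne' huv

/-- If `u` is among the `k` smallest for `g` but not for `f`, then some element that is not among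
the `k` smallest for `g` has an `f`-value at most that of `u`. -/
theorem exists_notMem_lowest_of_notMem (hu : u ∉ lowest f k) (hu' : u ∈ lowest g k) :
    ∃ z, z ∉ lowest g k ∧ f z ≤ f u := by
  classical
  by_contra! hz
  simp only [lowest, Finset.mem_filter, Finset.mem_univ, true_and, not_lt] at hu
  -- Otherwise `u` and its at least `k` predecessors for `f` would all be among the `k` lowest for
  -- `g`.
  have hsub : insert u (Finset.univ.filter fun x => f x < f u ∨ (f x = f u ∧ x < u)) ⊆
      lowest g k := by
    intro x hx
    rcases Finset.mem_insert.1 hx with rfl | hx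
    · exact hu'
    · by_contra hxg
      have := hz x hxg
      simp only [Finset.mem_filter, Finset.mem_univ, true_and] at hx
      grind
  have h1 := (Finset.card_le_card hsub).trans (card_lowest_le g k)
  rw [Finset.card_insert_of_notMem (by simp)] at h1
  omega

theorem exists_lowest_enum [Nonempty V] (f : V → α) (k : ℕ) :
    ∃ e : Fin k → V, ∀ v ∈ lowest f k, ∃ i, e i = v := by
  classical
  obtain ⟨φ⟩ := Function.Embedding.nonempty_of_card_le (α := lowest f k) (β := Fin k)
    (by simpa using card_lowest_le f k)
  refine ⟨fun i => if h : ∃ v, φ v = i then h.choose else Classical.arbitrary V,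
    fun v hv => ⟨φ ⟨v, hv⟩, ?_⟩⟩
  have h : ∃ w, φ w = φ ⟨v, hv⟩ := ⟨_, rfl⟩
  simp only [dif_pos h, φ.injective h.choose_spec]

/-- A list of `k` elements that contains the `k` smallest ones for `f`. -/
noncomputable def lowestEnum [Nonempty V] (f : V → α) (k : ℕ) : Fin k → V :=
  (exists_lowest_enum f k).choose

theorem exists_lowestEnum_eq [Nonempty V] (hv : v ∈ lowest f k) : ∃ i, lowestEnum f k i = v :=
  (exists_lowest_enum f k).choose_spec v hv

end Lowest

namespace WDigraph

/-! ### Local knowledge yields a hopset. -/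

section Hopset

variable {V : Type} [Fintype V] [LinearOrder V] {G H : WDigraph V} {k : ℕ} {u v x : V}

/-- If `x` lies on a shortest path from `u` to `v` and `v` is among the `k` nodes nearest to `u`,
then `v` is among the `k` nodes nearest to `x`. -/
theorem mem_nearest_of_dist_add {A B : ℕ} (hv : v ∈ G.nearest k u) (hux : G.dist u x = A)
    (hxv : G.dist x v = B) (huv : G.dist u v = (A + B : ℕ)) : v ∈ G.nearest k x := by
  -- `nearest` unfolds to `lowest` of the distance. Nodes preceding `v` as seen from `x` also
  -- precede it as seen from `u`.
  refine mem_lowest_of_imp hv fun z hz => ?_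
  have htri := G.dist_triangle u x z
  rw [hux] at htri
  rw [hxv] at hz
  rw [huv]
  push_cast
  rcases hz with hz | ⟨hz, hlt⟩
  · exact Or.inl (htri.trans_lt ((ENat.add_lt_add_iff_left (ENat.natCast_ne_top A)).2 hz))
  · rw [hz] at htri
    exact htri.lt_or_eq.imp id fun h => ⟨h, hlt⟩

/-- The first edge of a shortest path to one of the `k` nearest nodes is among the `k` lightest
outgoing edges. -/
theorem mem_lowest_w_of_dist_add {l B : ℕ} (hv : v ∈ G.nearest k u) (hw : G.w u x = l)
    (hxv : G.dist x v = B) (huv : G.dist u v = (l + B : ℕ)) : x ∈ lowest (G.w u) k := by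
  have hux : G.dist u x = l := by
    refine le_antisymm (hw ▸ G.dist_le_w u x) ?_
    have h1 := G.dist_triangle u x v
    rw [huv, hxv] at h1
    push_cast at h1
    exact (ENat.add_le_add_iff_right (ENat.natCast_ne_top B)).1 h1
  have hx : x ∈ lowest (G.dist u) k := by
    rcases Nat.eq_zero_or_pos B with rfl | hB
    · obtain rfl := eq_of_dist_eq_zero (by simpa using hxv)
      exact hv
    · refine mem_lowest_of_lt hv ?_
      rw [hux, huv]
      exact_mod_cast (by omega : l < l + B)
  -- Weights dominate distances, with equality at `x`, so whatever precedes `x` by weight precedes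
  -- it by distance.
  refine mem_lowest_of_imp hx fun z hz => ?_
  have hz' := G.dist_le_w u z
  rw [hw] at hz
  rw [hux]
  rcases hz with hz | ⟨hz, hlt⟩
  · exact Or.inl (hz'.trans_lt hz)
  · rw [hz] at hz'
    exact hz'.lt_or_eq.imp id fun h => ⟨h, hlt⟩

/-- Follow a shortest path to `v` inside a graph `K` that contains the `k` lightest outgoing edges
of all nodes of `S`, until the path leaves `S` or ends. -/
theorem exists_exit {K : WDigraph V} {S : Finset V}
    (hK : ∀ y ∈ S, ∀ z ∈ lowest (G.w y) k, K.w y z = G.w y z)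
    (hv : v ∈ G.nearest k u) {h B : ℕ} (hp : G.IsPath x v h B) {h' A : ℕ}
    (hq : K.IsPath u x h' A) (hux : G.dist u x = A) (huv : G.dist u v = (A + B : ℕ)) :
    ∃ (y : V) (h'' A' B' : ℕ), (y = v ∨ y ∉ S) ∧ K.IsPath u y h'' A' ∧ G.dist u y = A' ∧
      G.dist y v = B' ∧ A + B = A' + B' := by
  induction hp generalizing h' A with
  | nil x => exact ⟨x, h', A, 0, Or.inl rfl, hq, hux, by simp [dist_self], rfl⟩
  | @cons x x' v l h B hw hp ih =>
    have hxv : G.dist x v = (l + B : ℕ) := by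
      refine le_antisymm (IsPath.cons hw hp).dist_le ?_
      have h1 := G.dist_triangle u x v
      rw [huv, hux, Nat.cast_add] at h1
      exact (ENat.add_le_add_iff_left (ENat.natCast_ne_top A)).1 h1
    by_cases hxS : x ∈ S
    · have hx'v : G.dist x' v = B := by
        refine le_antisymm hp.dist_le ?_
        have h1 := (G.dist_triangle x x' v).trans (add_le_add_left (G.dist_le_w x x') _)
        rw [hxv, hw, Nat.cast_add] at h1
        exact (ENat.add_le_add_iff_left (ENat.natCast_ne_top l)).1 h1
      -- `v` is also among the nodes nearest to `x`, so `K` contains the next edge.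
      have hx' := mem_lowest_w_of_dist_add (mem_nearest_of_dist_add hv hux hxv huv) hw hx'v hxv
      have hux' : G.dist u x' = (A + l : ℕ) := by
        refine le_antisymm ?_ ?_
        · have h1 := (G.dist_triangle u x x').trans (add_le_add_right (G.dist_le_w x x') _)
          rw [hux, hw] at h1
          exact_mod_cast h1
        · have h1 := G.dist_triangle u x' v
          rw [huv, hx'v, ← Nat.add_assoc, Nat.cast_add] at h1
          exact (ENat.add_le_add_iff_right (ENat.natCast_ne_top B)).1 h1
      obtain ⟨y, h'', A', B', h1, h2, h3, h4, h5⟩ := ih hv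
        (by simpa using hq.trans (IsPath.cons ((hK x hxS x' hx').trans hw) (IsPath.nil x')))
        hux' (by rw [huv, Nat.add_assoc])
      exact ⟨y, h'', A', B', h1, h2, h3, h4, by omega⟩
    · exact ⟨x, h', A, l + B, Or.inr hxS, hq, hux, hxv, rfl⟩

/-- A node `y` on a shortest path to `v` that is not among the `k` nearest nodes according to the
approximation is at distance at least `d(u, v) / a`. -/
theorem dist_le_mul_of_notMem_lowest {a : ℝ} (ha : 1 ≤ a) {δ : V → V → ℝ≥0∞}
    (hδ : G.IsApproxAPSP a δ) (hv : v ∈ G.nearest k u) {y : V} {A B : ℕ}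
    (huy : G.dist u y = A) (huv : G.dist u v = (A + B : ℕ)) (hyv : G.dist y v = B)
    (hy : y ∉ lowest (δ u) k) : ((A + B : ℕ) : ℝ) ≤ a * A := by
  have hyn : y ∈ lowest (G.dist u) k := by
    rcases Nat.eq_zero_or_pos B with rfl | hB
    · obtain rfl := eq_of_dist_eq_zero (by simpa using hyv)
      exact hv
    · refine mem_lowest_of_lt hv ?_
      rw [huy, huv]
      exact_mod_cast (by omega : A < A + B)
  obtain ⟨z, hz, hle⟩ := exists_notMem_lowest_of_notMem hy hyn
  have h1 : G.dist u v ≤ G.dist u z := not_lt.1 fun h => hz (mem_lowest_of_lt hv h)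
  have h2 : ((G.dist u v : ℕ∞) : ℝ≥0∞) ≤ ENNReal.ofReal a * ((G.dist u y : ℕ∞) : ℝ≥0∞) :=
    (ENat.toENNReal_le.2 h1).trans (((hδ u z).1.trans hle).trans (hδ u y).2)
  rw [huv, huy, ENat.toENNReal_coe, ENat.toENNReal_coe, ← ENNReal.ofReal_natCast,
    ← ENNReal.ofReal_natCast, ← ENNReal.ofReal_mul (by linarith)] at h2
  exact (ENNReal.ofReal_le_ofReal_iff (by positivity)).1 h2

/-- Induction on the hop budget `t`: one hopset edge leads to the exit node `y`, from which the
remaining distance is at most `(1 - 1/a) L`. -/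
theorem exists_isPath_union_le {a : ℝ} (ha : 1 ≤ a) {δ : V → V → ℝ≥0∞} (hδ : G.IsApproxAPSP a δ)
    {K : V → WDigraph V} (hKG : ∀ u y z, G.w y z ≤ (K u).w y z)
    (hK : ∀ u, ∀ y ∈ lowest (δ u) k, ∀ z ∈ lowest (G.w y) k, (K u).w y z = G.w y z)
    (hH : ∀ u v, u ≠ v → (K u).dist u v = G.dist u v → H.w u v = G.dist u v) (t : ℕ) :
    ∀ u, ∀ v ∈ G.nearest k u, ∀ L : ℕ, G.dist u v = L → (L : ℝ) * (1 - 1 / a) ^ t < 1 →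
      ∃ h ≤ t, (G.union H).IsPath u v h L := by
  have hGK : ∀ u v, G.dist u v ≤ (K u).dist u v := fun u =>
    dist_le_dist_of_forall_dist_le_w (fun y z => (G.dist_le_w y z).trans (hKG u y z)) u
  induction t with
  | zero =>
    intro u v _ L hL hlt
    obtain rfl : L = 0 := by
      rw [pow_zero, mul_one] at hlt
      have : L < 1 := by exact_mod_cast hlt
      omega
    obtain rfl := eq_of_dist_eq_zero (by simpa using hL)
    exact ⟨0, le_rfl, IsPath.nil _⟩
  | succ t ih =>
    intro u v hv L hL hlt
    rcases Nat.eq_zero_or_pos L with rfl | hL0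
    · obtain rfl := eq_of_dist_eq_zero (by simpa using hL)
      exact ⟨0, Nat.zero_le _, IsPath.nil _⟩
    obtain ⟨h, hp⟩ := exists_isPath_of_dist_eq hL
    obtain ⟨y, h', A, B, hy, hq, huy, hyv, hAB⟩ := exists_exit (K := K u) (hK u) hv hp
      (IsPath.nil u) (by simp [dist_self]) (by simpa using hL)
    obtain rfl : L = A + B := by omega
    have hle : ((A + B : ℕ) : ℝ) ≤ a * A := by
      rcases hy with rfl | hy
      · have hB : B = 0 := by
          rw [dist_self] at hyv
          exact_mod_cast hyv.symm
        subst hB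
        simpa using le_mul_of_one_le_left (Nat.cast_nonneg A) ha
      · exact dist_le_mul_of_notMem_lowest ha hδ hv huy hL hyv hy
    have hA : A ≠ 0 := by
      rintro rfl
      have : (0 : ℝ) < ((0 + B : ℕ) : ℝ) := by exact_mod_cast hL0
      simp at hle this
      linarith
    have hne : u ≠ y := by
      rintro rfl
      rw [dist_self] at huy
      exact hA (by exact_mod_cast huy.symm)
    have hHw : H.w u y = A :=
      (hH u y hne (le_antisymm (huy ▸ hq.dist_le) (hGK u y))).trans huy
    -- An edge of `G` from `u` to `y` cannot be lighter than the distance, so the minimum is the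
    -- hopset weight.
    have hUw : (G.union H).w u y = A :=
      (min_eq_right (by rw [hHw, ← huy]; exact G.dist_le_w u y)).trans hHw
    have hB : (B : ℝ) ≤ ((A + B : ℕ) : ℝ) * (1 - 1 / a) := by
      have ha0 : 0 < a := by linarith
      have : ((A + B : ℕ) : ℝ) / a ≤ A := by rw [div_le_iff₀ ha0]; linarith
      rw [mul_sub, mul_one, mul_one_div]
      push_cast at this ⊢
      linarith
    have hq0 : 0 ≤ (1 - 1 / a) ^ t := by
      have : 1 / a ≤ 1 := by rw [div_le_one (by linarith)]; exact ha
      exact pow_nonneg (by linarith) t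
    obtain ⟨m, hm, hpath⟩ := ih y v (mem_nearest_of_dist_add hv huy hyv hL) B hyv
      (lt_of_le_of_lt ((mul_le_mul_of_nonneg_right hB hq0).trans_eq (by ring)) hlt)
    exact ⟨m + 1, by omega, IsPath.cons hUw hpath⟩

/-- `(1 - 1/a)^t ≤ exp(-t/a) < 1/d` for `d > 0`; the `+ 1` after the floor makes the last inequality
strict. -/
theorem mul_one_sub_inv_pow_lt_one {a : ℝ} (ha : 1 ≤ a) {L d : ℕ} (hLd : L ≤ d) :
    (L : ℝ) * (1 - 1 / a) ^ (⌊a * Real.log d⌋₊ + 1) < 1 := by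
  rcases Nat.eq_zero_or_pos L with rfl | hL
  · simp
  have ha0 : 0 < a := by linarith
  have hd : (0 : ℝ) < d := by exact_mod_cast hL.trans_le hLd
  have h1 : 1 / a ≤ 1 := by rw [div_le_one ha0]; exact ha
  set t := ⌊a * Real.log d⌋₊ + 1 with ht
  have hlog : Real.log d < t / a := by
    rw [lt_div_iff₀ ha0, mul_comm, ht]
    exact_mod_cast Nat.lt_floor_add_one (a * Real.log d)
  have hpow : (1 - 1 / a) ^ t ≤ Real.exp (-(t / a)) := by
    calc (1 - 1 / a) ^ t ≤ Real.exp (-(1 / a)) ^ t :=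
          pow_le_pow_left₀ (by linarith) (Real.one_sub_le_exp_neg _) t
      _ = Real.exp (-(t / a)) := by rw [← Real.exp_nat_mul]; congr 1; ring
  calc (L : ℝ) * (1 - 1 / a) ^ t ≤ d * Real.exp (-(t / a)) :=
        mul_le_mul (by exact_mod_cast hLd) hpow (pow_nonneg (by linarith) t) hd.le
    _ < d * Real.exp (-Real.log d) := by
        refine mul_lt_mul_of_pos_left (Real.exp_lt_exp.2 ?_) hd
        linarith
    _ = 1 := by rw [Real.exp_neg, Real.exp_log hd, mul_inv_cancel₀ hd.ne']

/-- If every node `u` knows the `k` lightest outgoing edges of its `k` nearest nodes according to an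
`a`-approximation of the distances, then the edges weighted with the distances from `u` in the graph
`K u` of the known edges form a `k`-nearest hopset. -/
theorem isNearestHopset_of_localGraph {a : ℝ} (ha : 1 ≤ a) {δ : V → V → ℝ≥0∞}
    (hδ : G.IsApproxAPSP a δ) {K : V → WDigraph V} (hKG : ∀ u y z, G.w y z ≤ (K u).w y z)
    (hK : ∀ u, ∀ y ∈ lowest (δ u) k, ∀ z ∈ lowest (G.w y) k, (K u).w y z = G.w y z)
    (hHK : ∀ u v, (K u).dist u v ≤ H.w u v)
    (hH : ∀ u v, u ≠ v → (K u).dist u v = G.dist u v → H.w u v = G.dist u v) :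
    G.IsNearestHopset H k (⌊a * Real.log G.weightedDiam⌋₊ + 1) := by
  refine ⟨fun u v => le_antisymm ?_ ?_, fun u v hv L hL => ?_⟩
  · exact dist_le_dist_of_forall_dist_le_w
      (fun y z => ((G.union H).dist_le_w y z).trans (min_le_left _ _)) u v
  · refine dist_le_dist_of_forall_dist_le_w (fun y z => le_min (G.dist_le_w y z) ?_) u v
    exact (dist_le_dist_of_forall_dist_le_w
      (fun y' z' => (G.dist_le_w y' z').trans (hKG y y' z')) y z).trans (hHK y z)
  · refine exists_isPath_union_le ha hδ hKG hK hH _ u v hv L hL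
      (mul_one_sub_inv_pow_lt_one ha ?_)
    have := Finset.le_sup (f := fun p : V × V => (G.dist p.1 p.2).toNat) (Finset.mem_univ (u, v))
    simpa only [hL, ENat.toNat_natCast, weightedDiam] using this

end Hopset

end WDigraph

/-! ### Algorithms that remember all messages. -/

namespace CliqueAlg

variable {n B : ℕ} {I O M : Type}

/-- The algorithm in which every node stores its input and all messages received so far; messages
are taken from a type `M` that is encoded into `B` bits. The value `m₀` fills the part of the
history that lies in the future. -/
def ofHistory (enc : M → Fin B → Bool) (dec : (Fin B → Bool) → M) (m₀ : M)
    (send : ℕ → Fin n → I → (ℕ → Fin n → M) → Fin n → M)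
    (output : Fin n → I → (ℕ → Fin n → M) → O) : CliqueAlg n B I O where
  State := I × (ℕ → Fin n → M)
  init _ i := (i, fun _ _ => m₀)
  send r u s v := enc (send r u s.1 s.2 v)
  step r _ s m := (s.1, Function.update s.2 r fun u => dec (m u))
  output v s := output v s.1 s.2

/-- The history of the messages received by each node in the first `r` rounds. -/
def history (m₀ : M) (send : ℕ → Fin n → I → (ℕ → Fin n → M) → Fin n → M) (inp : Fin n → I) :
    ℕ → Fin n → ℕ → Fin n → M
  | 0, _ => fun _ _ => m₀
  | r + 1, v => Function.update (history m₀ send inp r v) r fun u =>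
      send r u (inp u) (history m₀ send inp r u) v

theorem stateAt_ofHistory {enc : M → Fin B → Bool} {dec : (Fin B → Bool) → M}
    (hdec : Function.LeftInverse dec enc) (m₀ : M)
    (send : ℕ → Fin n → I → (ℕ → Fin n → M) → Fin n → M)
    (output : Fin n → I → (ℕ → Fin n → M) → O) (inp : Fin n → I) (r : ℕ) (v : Fin n) :
    (ofHistory enc dec m₀ send output).stateAt inp r v =
      (inp v, history m₀ send inp r v) := by
  induction r generalizing v with
  | zero => rfl
  | succ r ih =>
    rw [stateAt, history]
    simp only [ih]
    simp only [ofHistory, hdec _]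

theorem run_ofHistory {enc : M → Fin B → Bool} {dec : (Fin B → Bool) → M}
    (hdec : Function.LeftInverse dec enc) (m₀ : M)
    (send : ℕ → Fin n → I → (ℕ → Fin n → M) → Fin n → M)
    (output : Fin n → I → (ℕ → Fin n → M) → O) (inp : Fin n → I) (r : ℕ) (v : Fin n) :
    (ofHistory enc dec m₀ send output).run r inp v =
      output v (inp v) (history m₀ send inp r v) := by
  rw [run, stateAt_ofHistory hdec]
  rfl

end CliqueAlg

/-! ### Fitting weights into messages. -/

section Truncation

variable {Q : ℕ}

/-- The part of a weight that fits into a message: weights that are at least `Q` become `⊤`. -/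
noncomputable def truncWeight (Q : ℕ) (x : ℕ∞) : Option (Fin Q) :=
  if h : x ≠ ⊤ ∧ x.toNat < Q then some ⟨x.toNat, h.2⟩ else none

/-- The weight described by a truncated weight. -/
def weightOf : Option (Fin Q) → ℕ∞
  | none => ⊤
  | some i => (i : ℕ)

theorem weightOf_truncWeight_of_lt {x : ℕ∞} (hx : x ≠ ⊤ → x < Q) :
    weightOf (truncWeight Q x) = x := by
  by_cases h : x = ⊤
  · simp [truncWeight, weightOf, h]
  · obtain ⟨m, rfl⟩ := ENat.ne_top_iff_exists.1 h
    have hm : m < Q := by exact_mod_cast hx h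
    simp [truncWeight, weightOf, hm]

/-- Truncation only raises weights, so it never produces an edge that undercuts a distance. -/
theorem le_weightOf_truncWeight (x : ℕ∞) : x ≤ weightOf (truncWeight Q x) := by
  by_cases h : x ≠ ⊤ ∧ x.toNat < Q
  · simp [truncWeight, weightOf, h, ENat.natCast_toNat h.1]
  · simp [truncWeight, weightOf, h]

end Truncation

/-! ### Graphs assembled from received edges. -/

namespace WDigraph

/-- The graph with the edges from `ys i` to `(e i).1` of weight `(e i).2`, where loops are dropped
and weights are made positive. -/
noncomputable def ofEdges {V ι : Type} [DecidableEq V] (ys : ι → V) (e : ι → V × ℕ∞) :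
    WDigraph V where
  w y z := if y = z then ⊤ else max 1 (⨅ i, ⨅ _ : ys i = y ∧ (e i).1 = z, (e i).2)
  loopless v := by simp
  pos u v := by
    split_ifs
    · exact ENat.top_pos
    · exact lt_max_of_lt_left zero_lt_one

variable {V ι : Type} [DecidableEq V] {ys : ι → V} {e : ι → V × ℕ∞} {G : WDigraph V}

theorem w_le_ofEdges (he : ∀ i, G.w (ys i) (e i).1 ≤ (e i).2) (y z : V) :
    G.w y z ≤ (ofEdges ys e).w y z := by
  simp only [ofEdges]
  split_ifs
  · exact le_top
  · refine le_max_of_le_right (le_iInf fun i => le_iInf ?_)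
    rintro ⟨rfl, rfl⟩
    exact he i

/-- Every report bounds the true weight from above and report `i` attains it; the `max 1` is
harmless because true weights are positive. -/
theorem ofEdges_w_eq (he : ∀ i, G.w (ys i) (e i).1 ≤ (e i).2) {i : ι}
    (hi : (e i).2 = G.w (ys i) (e i).1) :
    (ofEdges ys e).w (ys i) (e i).1 = G.w (ys i) (e i).1 := by
  refine le_antisymm ?_ (w_le_ofEdges he _ _)
  simp only [ofEdges]
  split_ifs with h
  · rw [← h, G.loopless]
  · exact max_le (Order.one_le_iff_pos.2 (G.pos _ _))
      ((iInf₂_le i ⟨rfl, rfl⟩).trans_eq hi)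

end WDigraph

/-! ### The four-round algorithm and its correctness. -/

namespace HopsetAlg

variable {n : ℕ} (k Q : ℕ)

/-- Messages consist of four slots, each holding an identifier and a weight. -/
abbrev Msg (n Q : ℕ) : Type := Fin 4 → Fin n × Option (Fin Q)

/-- The graph of the edges that `u` knows from the replies `m`. -/
noncomputable def known [Nonempty (Fin n)] (slot : Fin n × Fin 4 → Fin k × Fin k)
    (δu : Fin n → ℝ≥0∞) (m : Fin n → Msg n Q) : WDigraph (Fin n) :=
  WDigraph.ofEdges (fun q : Fin n × Fin 4 => lowestEnum δu k (slot q).2)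
    fun q => ((m q.1 q.2).1, weightOf (m q.1 q.2).2)

/-- The truncated weight of the hopset edge from `u` to `v`. -/
noncomputable def hopsetEdge [Nonempty (Fin n)] (slot : Fin n × Fin 4 → Fin k × Fin k)
    (δu : Fin n → ℝ≥0∞) (m : Fin n → Msg n Q) (u v : Fin n) : Option (Fin Q) :=
  truncWeight Q (if u = v then ⊤ else (known k Q slot δu m).dist u v)

/-- The communication of the hopset algorithm. The slot `q = (x, s)` of node `x` is in charge of
edge number `(slot q).1` of the node that asks with its entry number `(slot q).2`.
Round 0: every node distributes its `k` lightest outgoing edges to the slots.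
Round 1: every node asks the slots for the edges of its `k` approximately nearest nodes.
Round 2: the slots reply.
Round 3: every node announces its outgoing hopset edges. -/
noncomputable def send [Nonempty (Fin n)] (slot : Fin n × Fin 4 → Fin k × Fin k) :
    ℕ → Fin n → IncidentEdges n × (Fin n → ℝ≥0∞) → (ℕ → Fin n → Msg n Q) → Fin n → Msg n Q
  | 0, _, i, _, x => fun s =>
      (lowestEnum i.1.outW k (slot (x, s)).1,
        truncWeight Q (i.1.outW (lowestEnum i.1.outW k (slot (x, s)).1)))
  | 1, _, i, _, x => fun s => (lowestEnum i.2 k (slot (x, s)).2, none)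
  | 2, _, _, hist, u => fun s => hist 0 (hist 1 u s).1 s
  | _ + 3, u, i, hist, v => fun _ => (u, hopsetEdge k Q slot i.2 (hist 2) u v)

/-- The local output of the hopset algorithm. -/
noncomputable def output [Nonempty (Fin n)] (slot : Fin n × Fin 4 → Fin k × Fin k) (v : Fin n)
    (i : IncidentEdges n × (Fin n → ℝ≥0∞)) (hist : ℕ → Fin n → Msg n Q) : IncidentEdges n where
  outW x := weightOf (hopsetEdge k Q slot i.2 (hist 2) v x)
  inW x := weightOf (hist 3 x 0).2

/-- The replies that `u` receives in round 2. -/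
noncomputable def replies [Nonempty (Fin n)] (slot : Fin n × Fin 4 → Fin k × Fin k)
    (G : WDigraph (Fin n)) (δu : Fin n → ℝ≥0∞) (x : Fin n) : Msg n Q := fun s =>
  let y := lowestEnum δu k (slot (x, s)).2
  let z := lowestEnum (G.w y) k (slot (x, s)).1
  (z, truncWeight Q (G.w y z))

variable {k Q} {slot : Fin n × Fin 4 → Fin k × Fin k} {G : WDigraph (Fin n)}

section

variable [Nonempty (Fin n)] {δu : Fin n → ℝ≥0∞}

theorem w_le_weightOf_replies (q : Fin n × Fin 4) :
    G.w (lowestEnum δu k (slot q).2) (replies k Q slot G δu q.1 q.2).1 ≤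
      weightOf (replies k Q slot G δu q.1 q.2).2 :=
  le_weightOf_truncWeight _

theorem w_le_known (y z : Fin n) :
    G.w y z ≤ (known k Q slot δu (replies k Q slot G δu)).w y z :=
  WDigraph.w_le_ofEdges (fun q => w_le_weightOf_replies q) y z

theorem known_w_eq (hslot : Function.Surjective slot) (hQ : ∀ y z, G.w y z ≠ ⊤ → G.w y z < Q)
    {y z : Fin n} (hy : y ∈ lowest δu k) (hz : z ∈ lowest (G.w y) k) :
    (known k Q slot δu (replies k Q slot G δu)).w y z = G.w y z := by
  obtain ⟨j, rfl⟩ := exists_lowestEnum_eq hy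
  obtain ⟨i, rfl⟩ := exists_lowestEnum_eq hz
  -- Some slot is in charge of edge `i` of entry `j`, so its reply contains the wanted edge.
  obtain ⟨q, hq⟩ := hslot (i, j)
  have := WDigraph.ofEdges_w_eq (G := G) (ys := fun q => lowestEnum δu k (slot q).2)
    (e := fun q => ((replies k Q slot G δu q.1 q.2).1,
      weightOf (replies k Q slot G δu q.1 q.2).2))
    (fun q => w_le_weightOf_replies q) (i := q)
    (weightOf_truncWeight_of_lt (hQ _ _))
  simpa only [known, replies, Prod.mk.eta, hq] using this

end

/-- The hopset computed by the algorithm. -/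
noncomputable def hopset [Nonempty (Fin n)] (k Q : ℕ) (slot : Fin n × Fin 4 → Fin k × Fin k)
    (G : WDigraph (Fin n)) (δ : Fin n → Fin n → ℝ≥0∞) : WDigraph (Fin n) where
  w u v := weightOf (hopsetEdge k Q slot (δ u) (replies k Q slot G (δ u)) u v)
  loopless v := by simp [hopsetEdge, truncWeight, weightOf]
  pos u v := by
    refine lt_of_lt_of_le ?_ (le_weightOf_truncWeight _)
    split_ifs with h
    · exact ENat.top_pos
    · exact pos_iff_ne_zero.2 fun h0 => h (WDigraph.eq_of_dist_eq_zero h0)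

/-- Finite distances are at most `n * W < Q`, so truncation keeps every exact hopset edge. -/
theorem isNearestHopset_hopset [Nonempty (Fin n)] {a : ℝ} (ha : 1 ≤ a)
    {δ : Fin n → Fin n → ℝ≥0∞} (hδ : G.IsApproxAPSP a δ) (hslot : Function.Surjective slot)
    {W : ℕ} (hW : ∀ u v, G.w u v ≠ ⊤ → G.w u v ≤ W) (hQ : n * W < Q) :
    G.IsNearestHopset (hopset k Q slot G δ) k (⌊a * Real.log G.weightedDiam⌋₊ + 1) := by
  have hWQ : W < Q :=
    (Nat.le_mul_of_pos_left W (Fin.pos_iff_nonempty.2 inferInstance)).trans_lt hQ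
  refine WDigraph.isNearestHopset_of_localGraph ha hδ
    (K := fun u => known k Q slot (δ u) (replies k Q slot G (δ u)))
    (fun u => w_le_known)
    (fun u y hy z hz => known_w_eq hslot
      (fun y z h => (hW y z h).trans_lt (by exact_mod_cast hWQ)) hy hz) ?_ ?_
  · intro u v
    refine le_trans ?_ (le_weightOf_truncWeight _)
    split_ifs
    · exact le_top
    · exact le_rfl
  · intro u v huv hd
    simp only [hopset, hopsetEdge, if_neg huv, hd]
    refine weightOf_truncWeight_of_lt fun h => ?_
    obtain ⟨L, hL⟩ := ENat.ne_top_iff_exists.1 h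
    have := WDigraph.dist_le_card_mul hW hL.symm
    rw [Fintype.card_fin] at this
    rw [← hL]
    exact_mod_cast this.trans_lt hQ

theorem output_history [Nonempty (Fin n)] (m₀ : Msg n Q) (δ : Fin n → Fin n → ℝ≥0∞)
    (v : Fin n) :
    output k Q slot v (G.incident v, δ v)
      (CliqueAlg.history m₀ (send k Q slot) (fun x => (G.incident x, δ x)) 4 v) =
      (hopset k Q slot G δ).incident v := by
  -- Evaluating the four history updates, the slot's round 2 reply looks up the round 0 message of
  -- the node named in round 1, which is what `replies` describes.
  rfl

end HopsetAlg

/-! ### Counting slots and message bits. -/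

theorem exists_slot_surjective {n : ℕ} (hn : 1 ≤ n) :
    ∃ slot : Fin n × Fin 4 → Fin ⌈Real.sqrt n⌉₊ × Fin ⌈Real.sqrt n⌉₊,
      Function.Surjective slot := by
  have hn1 : (1 : ℝ) ≤ n := by exact_mod_cast hn
  have hs : 1 ≤ Real.sqrt n := Real.one_le_sqrt.2 hn1
  have hk := (Nat.ceil_lt_add_one (Real.sqrt_nonneg n)).le
  have hk0 : 0 < ⌈Real.sqrt n⌉₊ := Nat.ceil_pos.2 (by linarith)
  have hsq := Real.mul_self_sqrt (Nat.cast_nonneg (α := ℝ) n)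
  have hcard : ⌈Real.sqrt n⌉₊ * ⌈Real.sqrt n⌉₊ ≤ n * 4 := by
    have : (⌈Real.sqrt n⌉₊ : ℝ) * ⌈Real.sqrt n⌉₊ ≤ n * 4 := by
      -- Rounding up at most doubles `√n ≥ 1`; squaring gives the factor four, the number of slots
      -- per message.
      have h2 : (⌈Real.sqrt n⌉₊ : ℝ) ≤ 2 * Real.sqrt n := by linarith
      have := mul_le_mul h2 h2 (Nat.cast_nonneg _) (by linarith)
      linarith
    exact_mod_cast this
  obtain ⟨φ⟩ := Function.Embedding.nonempty_of_card_le
    (α := Fin ⌈Real.sqrt n⌉₊ × Fin ⌈Real.sqrt n⌉₊) (β := Fin n × Fin 4) (by simpa using hcard)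
  have : Nonempty (Fin ⌈Real.sqrt n⌉₊ × Fin ⌈Real.sqrt n⌉₊) := ⟨⟨0, hk0⟩, ⟨0, hk0⟩⟩
  exact ⟨Function.invFun φ, Function.invFun_surjective φ.injective⟩

theorem exists_encoding {n p : ℕ} (hn : 2 ≤ n) :
    ∃ (enc : HopsetAlg.Msg n (n ^ (p + 2)) → Fin (4 * (p + 4) * Nat.clog 2 n) → Bool)
      (dec : (Fin (4 * (p + 4) * Nat.clog 2 n) → Bool) → HopsetAlg.Msg n (n ^ (p + 2))),
      Function.LeftInverse dec enc := by
  have hcard : Fintype.card (HopsetAlg.Msg n (n ^ (p + 2))) ≤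
      Fintype.card (Fin (4 * (p + 4) * Nat.clog 2 n) → Bool) := by
    simp only [Fintype.card_pi, Fintype.card_prod, Fintype.card_option, Fintype.card_fin,
      Fintype.card_bool, Finset.prod_const, Finset.card_univ]
    have h1 : n ^ (p + 2) + 1 ≤ n ^ (p + 3) := by
      have : 1 ≤ n ^ (p + 2) := Nat.one_le_pow _ _ (by omega)
      calc n ^ (p + 2) + 1 ≤ n ^ (p + 2) * 2 := by omega
        _ ≤ n ^ (p + 2) * n := Nat.mul_le_mul_left _ hn
        _ = n ^ (p + 3) := (pow_succ _ _).symm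
    calc (n * (n ^ (p + 2) + 1)) ^ 4 ≤ (n * n ^ (p + 3)) ^ 4 :=
          Nat.pow_le_pow_left (Nat.mul_le_mul_left _ h1) 4
      _ = n ^ (4 * (p + 4)) := by ring
      _ ≤ (2 ^ Nat.clog 2 n) ^ (4 * (p + 4)) :=
          Nat.pow_le_pow_left (Nat.le_pow_clog (by norm_num) n) _
      _ = 2 ^ (4 * (p + 4) * Nat.clog 2 n) := by rw [← pow_mul, mul_comm]
  obtain ⟨φ⟩ := Function.Embedding.nonempty_of_card_le hcard
  have : Nonempty (HopsetAlg.Msg n (n ^ (p + 2))) := ⟨fun _ => (⟨0, by omega⟩, none)⟩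
  exact ⟨φ, Function.invFun φ, Function.leftInverse_invFun φ.injective⟩

theorem lemma3p2 :
    ∃ (C : ℝ) (R : ℕ), ∀ p : ℕ, ∃ c : ℕ, ∀ n : ℕ,
      ∃ A : CliqueAlg n (c * Nat.clog 2 n) (IncidentEdges n × (Fin n → ℝ≥0∞)) (IncidentEdges n),
        ∀ (G : WDigraph (Fin n)) (a : ℝ) (δ : Fin n → Fin n → ℝ≥0∞),
          (∀ u v, G.w u v ≠ ⊤ → G.w u v ≤ ((n ^ p : ℕ) : ℕ∞)) →
          1 ≤ a → G.IsApproxAPSP a δ →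
          ∃ (H : WDigraph (Fin n)) (β : ℕ),
            (∀ v, A.run R (fun x => (G.incident x, δ x)) v = H.incident v) ∧
            (β : ℝ) ≤ C * (a * Real.log (G.weightedDiam : ℝ) + 1) ∧
            G.IsNearestHopset H ⌈Real.sqrt (n : ℝ)⌉₊ β := by
  refine ⟨1, 4, fun p => ⟨4 * (p + 4), fun n => ?_⟩⟩
  have hβ : ∀ (G : WDigraph (Fin n)) (a : ℝ), 1 ≤ a →
      ((⌊a * Real.log G.weightedDiam⌋₊ + 1 : ℕ) : ℝ) ≤
        1 * (a * Real.log (G.weightedDiam : ℝ) + 1) := by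
    intro G a ha
    have := Nat.floor_le
      (mul_nonneg (zero_le_one.trans ha) (Real.log_natCast_nonneg G.weightedDiam))
    push_cast
    linarith
  -- For `n < 2` messages have no bits, since `Nat.clog 2 n = 0`, so the encoding is unavailable.
  rcases Nat.lt_or_ge n 2 with hn | hn
  · -- With at most one node there are no edges, and the input is returned.
    have hsub : Subsingleton (Fin n) := Fin.subsingleton_iff_le_one.2 (by omega)
    refine ⟨⟨IncidentEdges n, fun _ i => i.1, fun _ _ _ _ _ => false, fun _ _ s _ => s,
      fun _ s => s⟩, fun G a δ _ ha hδ => ⟨G, _, fun v => rfl, hβ G a ha, ?_⟩⟩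
    exact WDigraph.isNearestHopset_of_localGraph ha hδ (K := fun _ => G) (fun _ _ _ => le_rfl)
      (fun _ _ _ _ _ => rfl) G.dist_le_w fun u v huv => absurd (Subsingleton.elim u v) huv
  · have hne : Nonempty (Fin n) := ⟨⟨0, by omega⟩⟩
    obtain ⟨slot, hslot⟩ := exists_slot_surjective (n := n) (by omega)
    obtain ⟨enc, dec, hdec⟩ := exists_encoding (p := p) hn
    refine ⟨CliqueAlg.ofHistory enc dec (fun _ => (⟨0, by omega⟩, none))
      (HopsetAlg.send _ _ slot) (HopsetAlg.output _ _ slot), fun G a δ hw ha hδ =>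
        ⟨HopsetAlg.hopset _ (n ^ (p + 2)) slot G δ, _, fun v => ?_, hβ G a ha, ?_⟩⟩
    · rw [CliqueAlg.run_ofHistory hdec]
      exact HopsetAlg.output_history _ δ v
    · refine HopsetAlg.isNearestHopset_hopset ha hδ hslot hw ?_
      -- The largest possible distance is `n * n ^ p = n ^ (p + 1)`, below the threshold `n ^ (p +
      -- 2)`.
      rw [← pow_succ']
      exact Nat.pow_lt_pow_right hn (by omega)
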